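/- Let $n\ge 2$ and $j\ge 1$ be integers, let $\mathcal S^n$ be the unit sphere of $\mathbb R^{n+1}$, and put $\lambda=\frac{n-1}{2}$. Let $C_l^\lambda$, $l\in\mathbb N_0$, be the Gegenbauer polynomials, given by $$\sum_{l=0}^\infty C_l^\lambda(t)\,r^l=\frac{1}{(1-2tr+r^2)^\lambda}\qquad(t\in[-1,1],\ r\text{ near }0),$$ and let $$\varphi_j=\frac{1}{\sqrt2^{\,nj}}\sum_{l=0}^{2^{j-1}-1}\frac{l+\lambda}{\lambda}\,C_l^\lambda$$ be the weighted scaling function of scale $j$, as a function on $[-1,1]$. For a continuous function $G:[-1,1]\to\mathbb R$ and points $x_1,\dots,x_L\in\mathcal S^n$ consider the Gramian matrix $A=\left(G(x_i\cdot x_k)\right)_{i,k=1}^{L}$. The function $G$ is called positive definite on $\mathcal S^n$ if $A$ is positive semidefinite for every $L\in\mathbb N$ and all $x_1,\dots,x_L\in\mathcal S^n$; strictly positive definite of cardinality $L$ (for a fixed $L$) if $A$ is positive definite for all pairwise distinct $x_1,\dots,x_L\in\mathcal S^n$; and strictly positive definite on $\mathcal S^n$ if it is strictly positive definite of cardinality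 $L$ for every $L\in\mathbb N$. Then $\varphi_j$ is positive definite on $\mathcal S^n$ and strictly positive definite of cardinality $2^{j-1}$, but $\varphi_j$ is not strictly positive definite on $\mathcal S^n$. -/

import Mathlib

open scoped Topology

noncomputable section

namespace SphereScaling

/-- The Gegenbauer function `C_l^lam` of order `lam` and degree `l`: `C_l^lam(t)` is the
coefficient of `r ^ l` in the expansion of `(1 - 2 t r + r ^ 2) ^ (-lam)` around `r = 0`. -/
def gegenbauer (lam : ℝ) (l : ℕ) (t : ℝ) : ℝ :=
  iteratedDeriv l (fun r : ℝ => (1 - 2 * t * r + r ^ 2) ^ (-lam)) 0 / (Nat.factorial l : ℝ)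

/-- The defining generating series of the Gegenbauer functions converges to
`1 / (1 - 2 t r + r ^ 2) ^ lam` for all `r` near `0`. -/
theorem gegenbauer_generating (lam t : ℝ) :
    ∀ᶠ r in 𝓝 (0 : ℝ),
      HasSum (fun l : ℕ => gegenbauer lam l t * r ^ l) (1 / (1 - 2 * t * r + r ^ 2) ^ lam) := by
  have hpos : ∀ᶠ r in 𝓝 (0 : ℝ), 0 < 1 - 2 * t * r + r ^ 2 := by
    have hc : ContinuousAt (fun r : ℝ => 1 - 2 * t * r + r ^ 2) 0 := by fun_prop
    exact hc.eventually (lt_mem_nhds (by norm_num))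
  have hF : AnalyticAt ℝ (fun r : ℝ => (1 - 2 * t * r + r ^ 2) ^ (-lam)) 0 := by
    have hE : AnalyticAt ℝ
        (fun r : ℝ => Real.exp (Real.log (1 - 2 * t * r + r ^ 2) * (-lam))) 0 := by
      refine AnalyticAt.rexp (AnalyticAt.mul (AnalyticAt.log (by fun_prop) (by norm_num)) ?_)
      exact analyticAt_const
    refine hE.congr ?_
    filter_upwards [hpos] with r hp
    rw [Real.rpow_def_of_pos hp]
  filter_upwards [hF.hasFPowerSeriesAt.eventually_hasSum, hpos] with r hr hp
  rw [zero_add, Real.rpow_neg hp.le] at hr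
  rw [one_div]
  have hfun : (fun l : ℕ => gegenbauer lam l t * r ^ l) = fun l : ℕ =>
      (FormalMultilinearSeries.ofScalars ℝ (fun n : ℕ =>
        iteratedDeriv n (fun r : ℝ => (1 - 2 * t * r + r ^ 2) ^ (-lam)) 0 / (n.factorial : ℝ))) l
        fun _ => r := by
    funext l
    simp [gegenbauer, FormalMultilinearSeries.ofScalars]
  rw [hfun]
  exact hr

/-- The unit sphere `S^n` of the Euclidean space `ℝ^(n+1)`. -/
abbrev UnitSphere (n : ℕ) : Type :=
  Metric.sphere (0 : EuclideanSpace ℝ (Fin (n + 1))) 1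

/-- The Gramian matrix `(G (x_i · x_k))_{i,k}` of a finite sequence of points of `S^n`. -/
def gramian {n L : ℕ} (G : ℝ → ℝ) (x : Fin L → UnitSphere n) : Matrix (Fin L) (Fin L) ℝ :=
  Matrix.of fun i k =>
    G (inner ℝ (x i : EuclideanSpace ℝ (Fin (n + 1))) (x k : EuclideanSpace ℝ (Fin (n + 1))))

/-- `G` is continuous on `[-1, 1]` and positive definite on `S^n`: the Gramian matrix of every
finite sequence of points of `S^n` is positive semidefinite. -/
def IsPositiveDefinite (n : ℕ) (G : ℝ → ℝ) : Prop :=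
  ContinuousOn G (Set.Icc (-1) 1) ∧
    ∀ (L : ℕ) (x : Fin L → UnitSphere n), (gramian G x).PosSemidef

/-- `G` is continuous on `[-1, 1]` and strictly positive definite of cardinality `L` on `S^n`:
the Gramian matrix of any `L` pairwise distinct points of `S^n` is positive definite. -/
def IsStrictlyPositiveDefiniteOfCard (n L : ℕ) (G : ℝ → ℝ) : Prop :=
  ContinuousOn G (Set.Icc (-1) 1) ∧
    ∀ x : Fin L → UnitSphere n, Function.Injective x → (gramian G x).PosDef

/-- `G` is strictly positive definite on `S^n`: this holds for every number `L` of points. -/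
def IsStrictlyPositiveDefinite (n : ℕ) (G : ℝ → ℝ) : Prop :=
  ∀ L : ℕ, IsStrictlyPositiveDefiniteOfCard n L G

/-- The order `lam = (n - 1) / 2` belonging to the sphere `S^n`. -/
def order (n : ℕ) : ℝ := ((n : ℝ) - 1) / 2

/-- The weighted scaling function of scale `j` on `S^n`, as a zonal kernel (for `n ≥ 2` and
`j ≥ 1`). -/
def weightedScalingFunction (n j : ℕ) (t : ℝ) : ℝ :=
  1 / Real.sqrt 2 ^ (n * j) *
    ∑ l ∈ Finset.range (2 ^ (j - 1)),
      ((l : ℝ) + order n) / order n * gegenbauer (order n) l t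

end SphereScaling

end

/-! The Gram form of the kernel is a sum of squares. On polynomials in `n + 1` variables, the
Fischer form makes multiplication by `X i` adjoint to `pderiv i`. The homogeneous harmonic
polynomials `zonal` with pole `y`, equal to `l ! * C_l^lam(y · x)` on the sphere, satisfy a
reproducing formula (`fischer_zonal`): the Fischer product of two of them is a positive constant
times `C_l^lam(x · y)`. So the Gram form at `a` is a positively weighted sum, over `l < 2 ^ (j -
1)`, of Fischer norms of `∑ a i • zonal` (`dotProduct_gramian_mulVec`), hence nonnegative.

If it vanishes, so does each such combination, hence all moments `∑ a i * (x i · v) ^ m` with `m < 2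
^ (j - 1)`. For `2 ^ (j - 1)` distinct points and a `v` separating them, the Vandermonde determinant
forces `a = 0`. Strictness fails for large `L` because the zonal polynomials involved lie in a fixed
finite-dimensional space. -/

namespace SphereScaling

open MvPolynomial

/-! ### Three-term recurrence and continuity of the Gegenbauer functions. -/

section Gegenbauer

/-- The differential equation of the generating function, differentiated `l` times. -/
theorem generating_function_deriv_recurrence (lam t : ℝ) (l : ℕ) :
    ∀ᶠ r in 𝓝 (0 : ℝ),
      (1 - 2 * t * r + r ^ 2) *
          iteratedDeriv (l + 2) (fun r : ℝ => (1 - 2 * t * r + r ^ 2) ^ (-lam)) r +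
        2 * (r - t) * (l + 1 + lam) *
          iteratedDeriv (l + 1) (fun r : ℝ => (1 - 2 * t * r + r ^ 2) ^ (-lam)) r +
        (l + 1) * (l + 2 * lam) *
          iteratedDeriv l (fun r : ℝ => (1 - 2 * t * r + r ^ 2) ^ (-lam)) r = 0 := by
  set F : ℝ → ℝ := fun r => (1 - 2 * t * r + r ^ 2) ^ (-lam) with hF
  have hpos : ∀ᶠ r in 𝓝 (0 : ℝ), 0 < 1 - 2 * t * r + r ^ 2 := by
    have hc : ContinuousAt (fun r : ℝ => 1 - 2 * t * r + r ^ 2) 0 := by fun_prop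
    exact hc.eventually (lt_mem_nhds (by norm_num))
  have hq (r : ℝ) : HasDerivAt (fun r : ℝ => 1 - 2 * t * r + r ^ 2) (2 * (r - t)) r := by
    have h := (((hasDerivAt_id r).const_mul (2 * t)).const_sub 1).add ((hasDerivAt_id r).pow 2)
    refine h.congr_deriv ?_
    simp only [id, Nat.cast_ofNat]
    ring
  have hr (r : ℝ) : HasDerivAt (fun r : ℝ => 2 * (r - t)) 2 r := by
    simpa using ((hasDerivAt_id r).sub_const t).const_mul 2
  have hsmooth (m : ℕ) : ∀ᶠ r in 𝓝 (0 : ℝ),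
      HasDerivAt (iteratedDeriv m F) (iteratedDeriv (m + 1) F r) r := by
    filter_upwards [hpos] with r hp
    have hc : ContDiffAt ℝ ⊤ F r := ContDiffAt.rpow_const_of_ne (by fun_prop) hp.ne'
    have hd : DifferentiableAt ℝ (iteratedDeriv m F) r := by
      rw [iteratedDeriv_eq_iterate]
      exact (hc.analyticAt.iterated_deriv m).differentiableAt
    rw [iteratedDeriv_succ]
    exact hd.hasDerivAt
  -- An identity valid on a neighbourhood of `0` may be differentiated there.
  have hstep {f f' : ℝ → ℝ} (h : ∀ᶠ r in 𝓝 (0 : ℝ), f r = 0)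
      (hd : ∀ᶠ r in 𝓝 (0 : ℝ), HasDerivAt f (f' r) r) : ∀ᶠ r in 𝓝 (0 : ℝ), f' r = 0 := by
    filter_upwards [h.eventually_nhds, hd] with r hr hdr
    have h0 : HasDerivAt f 0 r :=
      (hasDerivAt_const r (0 : ℝ)).congr_of_eventuallyEq (by filter_upwards [hr] with s hs; exact hs)
    exact hdr.unique h0
  -- With `q = 1 - 2 t r + r ^ 2`, this is `q F' + lam q' F = 0`; the claim for `l` is its
  -- derivative of order `l + 1`.
  have hone : ∀ᶠ r in 𝓝 (0 : ℝ), (1 - 2 * t * r + r ^ 2) * iteratedDeriv 1 F r +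
      2 * (r - t) * lam * iteratedDeriv 0 F r = 0 := by
    filter_upwards [hpos] with r hp
    have hd := (hq r).rpow_const (p := -lam) (Or.inl hp.ne')
    rw [iteratedDeriv_one, iteratedDeriv_zero, hd.deriv, hF, Real.rpow_sub hp, Real.rpow_one]
    field_simp
    ring
  induction l with
  | zero =>
    have := hstep hone (f' := fun r => 2 * (r - t) * iteratedDeriv 1 F r +
        (1 - 2 * t * r + r ^ 2) * iteratedDeriv 2 F r +
        (2 * lam * iteratedDeriv 0 F r + 2 * (r - t) * lam * iteratedDeriv 1 F r)) (by
      filter_upwards [hsmooth 0, hsmooth 1] with r h0 h1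
      exact ((hq r).mul h1).add (((hr r).mul_const lam).mul h0))
    filter_upwards [this] with r h
    simp only [zero_add, Nat.cast_zero]
    linear_combination h
  | succ l ih =>
    have := hstep ih (f' := fun r => 2 * (r - t) * iteratedDeriv (l + 2) F r +
        (1 - 2 * t * r + r ^ 2) * iteratedDeriv (l + 3) F r +
        (2 * (l + 1 + lam) * iteratedDeriv (l + 1) F r +
          2 * (r - t) * (l + 1 + lam) * iteratedDeriv (l + 2) F r) +
        (l + 1) * (l + 2 * lam) * iteratedDeriv (l + 1) F r) (by
      filter_upwards [hsmooth l, hsmooth (l + 1), hsmooth (l + 2)] with r h0 h1 h2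
      exact (((hq r).mul h2).add (((hr r).mul_const (l + 1 + lam)).mul h1)).add
        (h0.const_mul ((l + 1) * (l + 2 * lam))))
    filter_upwards [this] with r h
    push_cast
    rw [show l + 1 + 2 = l + 3 by ring, show l + 1 + 1 = l + 2 by ring]
    linear_combination h

/-- The Taylor coefficients `l ! * C_l^lam(t)` of the generating function. -/
theorem factorial_mul_gegenbauer (lam t : ℝ) (l : ℕ) :
    (l.factorial : ℝ) * gegenbauer lam l t =
      iteratedDeriv l (fun r : ℝ => (1 - 2 * t * r + r ^ 2) ^ (-lam)) 0 := by
  rw [gegenbauer, mul_div_cancel₀]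
  exact_mod_cast l.factorial_ne_zero

theorem gegenbauer_zero (lam t : ℝ) : gegenbauer lam 0 t = 1 := by
  simp [gegenbauer]

theorem gegenbauer_one (lam t : ℝ) : gegenbauer lam 1 t = 2 * lam * t := by
  have hq : HasDerivAt (fun r : ℝ => 1 - 2 * t * r + r ^ 2) (-(2 * t)) 0 := by
    have h := (((hasDerivAt_id (0 : ℝ)).const_mul (2 * t)).const_sub 1).add
      ((hasDerivAt_id (0 : ℝ)).pow 2)
    refine h.congr_deriv ?_
    simp
  have hd := hq.rpow_const (p := -lam) (Or.inl (by norm_num))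
  simp only [gegenbauer, iteratedDeriv_one, hd.deriv]
  simp
  ring

/-- The three-term recurrence of the Gegenbauer polynomials. -/
theorem gegenbauer_add_two (lam t : ℝ) (l : ℕ) :
    ((l + 2).factorial : ℝ) * gegenbauer lam (l + 2) t =
      2 * (l + 1 + lam) * t * ((l + 1).factorial * gegenbauer lam (l + 1) t) -
        (l + 1) * (l + 2 * lam) * (l.factorial * gegenbauer lam l t) := by
  simp only [factorial_mul_gegenbauer]
  have h := (generating_function_deriv_recurrence lam t l).self_of_nhds
  linear_combination h

theorem continuous_gegenbauer (lam : ℝ) (l : ℕ) : Continuous (gegenbauer lam l) := by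
  induction l using Nat.twoStepInduction with
  | zero =>
    rw [show gegenbauer lam 0 = fun _ => 1 from funext (gegenbauer_zero lam)]
    exact continuous_const
  | one =>
    rw [show gegenbauer lam 1 = fun t => 2 * lam * t from funext (gegenbauer_one lam)]
    fun_prop
  | more l h0 h1 =>
    have h : gegenbauer lam (l + 2) = fun t =>
        (2 * (l + 1 + lam) * t * ((l + 1).factorial * gegenbauer lam (l + 1) t) -
          (l + 1) * (l + 2 * lam) * (l.factorial * gegenbauer lam l t)) /
            ((l + 2).factorial : ℝ) := by
      funext t
      rw [← gegenbauer_add_two, mul_div_cancel_left₀]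
      exact_mod_cast (l + 2).factorial_ne_zero
    rw [h]
    fun_prop

end Gegenbauer

/-! ### The Fischer inner product and its adjoint pairs. -/

section Fischer

variable {σ : Type*}

/-- The Fischer form `(p, q) ↦ ∑ m, m ! * coeff m p * coeff m q` on real polynomials. -/
noncomputable def fischer : MvPolynomial σ ℝ →ₗ[ℝ] MvPolynomial σ ℝ →ₗ[ℝ] ℝ :=
  (basisMonomials σ ℝ).constr ℝ fun m =>
    ((m.prod fun _ k => k.factorial : ℕ) : ℝ) • lcoeff ℝ m

theorem fischer_monomial (m : σ →₀ ℕ) (a : ℝ) (q : MvPolynomial σ ℝ) :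
    fischer (monomial m a) q = a * ((m.prod fun _ k => k.factorial : ℕ) * coeff m q) := by
  have h : monomial m a = a • basisMonomials σ ℝ m := by
    simp [smul_monomial]
  rw [h, map_smul, fischer, Module.Basis.constr_basis]
  simp

theorem fischer_self (p : MvPolynomial σ ℝ) :
    fischer p p = ∑ m ∈ p.support, ((m.prod fun _ k => k.factorial : ℕ) : ℝ) * coeff m p ^ 2 := by
  conv_lhs => enter [1, 2]; rw [p.as_sum]
  rw [map_sum, LinearMap.sum_apply]
  refine Finset.sum_congr rfl fun m _ => ?_
  rw [fischer_monomial]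
  ring

theorem prod_factorial_pos (m : σ →₀ ℕ) : 0 < (m.prod fun _ k => k.factorial) :=
  Finset.prod_pos fun _ _ => Nat.factorial_pos _

theorem fischer_self_nonneg (p : MvPolynomial σ ℝ) : 0 ≤ fischer p p := by
  rw [fischer_self]
  positivity

theorem fischer_self_eq_zero {p : MvPolynomial σ ℝ} (h : fischer p p = 0) : p = 0 := by
  rw [fischer_self, Finset.sum_eq_zero_iff_of_nonneg (fun _ _ => by positivity)] at h
  by_contra hp
  obtain ⟨m, hm⟩ := support_nonempty.mpr hp
  have h0 := h m hm
  have hpos : (0 : ℝ) < (m.prod fun _ k => k.factorial : ℕ) := by exact_mod_cast prod_factorial_pos m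
  have := mem_support_iff.mp hm
  have : 0 < ((m.prod fun _ k => k.factorial : ℕ) : ℝ) * coeff m p ^ 2 := by positivity
  linarith

/-- Multiplication by a variable is adjoint to differentiation. -/
theorem fischer_X_mul (i : σ) (p q : MvPolynomial σ ℝ) :
    fischer (X i * p) q = fischer p (pderiv i q) := by
  classical
  induction p using MvPolynomial.induction_on' with
  | monomial m a =>
    rw [X, monomial_mul, one_mul, fischer_monomial, fischer_monomial, coeff_pderiv,
      add_comm (Finsupp.single i 1) m]
    have h : ((m + Finsupp.single i 1).prod fun _ k => k.factorial) =
        (m i + 1) * m.prod fun _ k => k.factorial := by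
      rw [← Finsupp.mul_prod_erase' (m + Finsupp.single i 1) i _ (fun _ => rfl),
        ← Finsupp.mul_prod_erase' m i _ (fun _ => rfl), Finsupp.erase_add]
      simp [Nat.factorial_succ, mul_assoc]
    rw [h]
    push_cast
    ring
  | add p r hp hr => simp only [mul_add, map_add, LinearMap.add_apply, hp, hr]

variable [Fintype σ]

/-- The linear form `x ↦ y · x`. -/
noncomputable def linearForm (y : σ → ℝ) : MvPolynomial σ ℝ := ∑ i, C (y i) * X i

/-- The squared Euclidean norm. -/
noncomputable def normSqPoly : MvPolynomial σ ℝ := ∑ i, X i ^ 2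

/-- The derivative in the direction `y`. -/
noncomputable def dirDeriv (y : σ → ℝ) : Derivation ℝ (MvPolynomial σ ℝ) (MvPolynomial σ ℝ) :=
  ∑ i, y i • pderiv i

/-- The Laplace operator. -/
noncomputable def laplacian (p : MvPolynomial σ ℝ) : MvPolynomial σ ℝ := ∑ i, pderiv i (pderiv i p)

theorem dirDeriv_apply (y : σ → ℝ) (p : MvPolynomial σ ℝ) :
    dirDeriv y p = ∑ i, C (y i) * pderiv i p := by
  rw [dirDeriv, ← Derivation.coeFnAddMonoidHom_apply, map_sum, Finset.sum_apply]
  simp [smul_eq_C_mul]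

theorem fischer_linearForm_mul (y : σ → ℝ) (p q : MvPolynomial σ ℝ) :
    fischer (linearForm y * p) q = fischer p (dirDeriv y q) := by
  rw [linearForm, dirDeriv_apply, Finset.sum_mul, map_sum, LinearMap.sum_apply, map_sum]
  refine Finset.sum_congr rfl fun i _ => ?_
  rw [mul_assoc, ← smul_eq_C_mul, ← smul_eq_C_mul, map_smul, map_smul, LinearMap.smul_apply,
    fischer_X_mul]

theorem fischer_normSqPoly_mul (p q : MvPolynomial σ ℝ) :
    fischer (normSqPoly * p) q = fischer p (laplacian q) := by
  rw [normSqPoly, laplacian, Finset.sum_mul, map_sum, LinearMap.sum_apply, map_sum]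
  refine Finset.sum_congr rfl fun i _ => ?_
  rw [pow_two, mul_assoc, fischer_X_mul, fischer_X_mul]

theorem eval_dirDeriv {l : ℕ} {q : MvPolynomial σ ℝ} (hq : q.IsHomogeneous l) (y : σ → ℝ) :
    eval y (dirDeriv y q) = l * eval y q := by
  have h := congrArg (eval y) hq.sum_X_mul_pderiv
  simpa [dirDeriv_apply, map_sum] using h

theorem isHomogeneous_dirDeriv {l : ℕ} {q : MvPolynomial σ ℝ} (hq : q.IsHomogeneous (l + 1))
    (y : σ → ℝ) : (dirDeriv y q).IsHomogeneous l := by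
  rw [dirDeriv_apply]
  refine IsHomogeneous.sum _ _ _ fun i _ => ?_
  simpa using (hq.pderiv (i := i)).C_mul (y i)

/-- Powers of linear forms reproduce homogeneous polynomials. -/
theorem fischer_linearForm_pow {l : ℕ} {q : MvPolynomial σ ℝ} (hq : q.IsHomogeneous l)
    (y : σ → ℝ) : fischer (linearForm y ^ l) q = l.factorial * eval y q := by
  induction l generalizing q with
  | zero =>
    obtain ⟨a, rfl⟩ : ∃ a, q = C a := 
      ⟨_, totalDegree_eq_zero_iff_eq_C.mp ((totalDegree_zero_iff_isHomogeneous σ).mpr hq)⟩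
    rw [pow_zero, ← C_1, C_apply, fischer_monomial]
    simp
  | succ l ih =>
    rw [pow_succ', fischer_linearForm_mul, ih (isHomogeneous_dirDeriv hq y), eval_dirDeriv hq,
      Nat.factorial_succ]
    push_cast
    ring

theorem pderiv_linearForm (y : σ → ℝ) (i : σ) : pderiv i (linearForm y) = C (y i) := by
  classical
  simp [linearForm, map_sum, Derivation.leibniz, pderiv_X, Pi.single_apply]

theorem pderiv_normSqPoly (i : σ) : pderiv i (normSqPoly : MvPolynomial σ ℝ) = 2 * X i := by
  classical
  simp [normSqPoly, map_sum, pderiv_X, Pi.single_apply]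

theorem dirDeriv_linearForm {y : σ → ℝ} (hy : ∑ i, y i ^ 2 = 1) : dirDeriv y (linearForm y) = 1 := by
  simp only [dirDeriv_apply, pderiv_linearForm, ← pow_two, ← C_pow, ← map_sum, hy, C_1]

theorem dirDeriv_normSqPoly (y : σ → ℝ) : dirDeriv y normSqPoly = 2 * linearForm y := by
  simp only [dirDeriv_apply, pderiv_normSqPoly, linearForm, Finset.mul_sum]
  exact Finset.sum_congr rfl fun i _ => by ring

theorem laplacian_linearForm_mul (y : σ → ℝ) (p : MvPolynomial σ ℝ) :
    laplacian (linearForm y * p) = linearForm y * laplacian p + 2 * dirDeriv y p := by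
  simp only [laplacian, dirDeriv_apply, Finset.mul_sum, ← Finset.sum_add_distrib]
  refine Finset.sum_congr rfl fun i _ => ?_
  simp only [pderiv_mul, pderiv_linearForm, map_add, pderiv_C]
  ring

theorem laplacian_normSqPoly_mul {l : ℕ} {p : MvPolynomial σ ℝ} (hp : p.IsHomogeneous l) :
    laplacian (normSqPoly * p) =
      normSqPoly * laplacian p + C (4 * (l : ℝ) + 2 * Fintype.card σ) * p := by
  have h : laplacian (normSqPoly * p) =
      normSqPoly * laplacian p + 4 * ∑ i, X i * pderiv i p + ∑ _i : σ, 2 * p := by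
    simp only [laplacian, Finset.mul_sum, ← Finset.sum_add_distrib]
    refine Finset.sum_congr rfl fun i _ => ?_
    have h2 : pderiv i (2 * X i : MvPolynomial σ ℝ) = 2 := by
      rw [show (2 : MvPolynomial σ ℝ) = C 2 from rfl, pderiv_C_mul, pderiv_X_self, mul_one]
    simp only [pderiv_mul (f := normSqPoly), pderiv_mul (f := 2 * X i), pderiv_normSqPoly, map_add,
      h2]
    ring
  rw [h, hp.sum_X_mul_pderiv]
  simp only [Finset.sum_const, Finset.card_univ, nsmul_eq_mul, map_add, map_mul, map_natCast,
    map_ofNat]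
  ring

theorem laplacian_C_mul (a : ℝ) (p : MvPolynomial σ ℝ) : laplacian (C a * p) = C a * laplacian p := by
  simp only [laplacian, pderiv_C_mul, Finset.mul_sum]

theorem laplacian_sub (p q : MvPolynomial σ ℝ) : laplacian (p - q) = laplacian p - laplacian q := by
  simp only [laplacian, map_sub, Finset.sum_sub_distrib]

end Fischer

/-! ### Zonal harmonics, their reproducing formula, and moments. -/

section Zonal

variable {σ : Type*} [Fintype σ]

/-- The zonal polynomials with pole `y`, normalized so that `zonal lam y l` is
`l ! * C_l^lam(y · x)` on the unit sphere. -/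
noncomputable def zonal (lam : ℝ) (y : σ → ℝ) : ℕ → MvPolynomial σ ℝ
  | 0 => 1
  | 1 => C (2 * lam) * linearForm y
  | l + 2 => C (2 * (l + 1 + lam)) * (linearForm y * zonal lam y (l + 1)) -
      C ((l + 1) * (l + 2 * lam)) * (normSqPoly * zonal lam y l)

theorem isHomogeneous_linearForm (y : σ → ℝ) : (linearForm y).IsHomogeneous 1 :=
  IsHomogeneous.sum _ _ _ fun i _ => (isHomogeneous_X ℝ i).C_mul (y i)

theorem isHomogeneous_normSqPoly : (normSqPoly : MvPolynomial σ ℝ).IsHomogeneous 2 :=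
  IsHomogeneous.sum _ _ _ fun i _ => by simpa using (isHomogeneous_X ℝ i).pow 2

theorem isHomogeneous_zonal (lam : ℝ) (y : σ → ℝ) (l : ℕ) : (zonal lam y l).IsHomogeneous l := by
  induction l using Nat.twoStepInduction with
  | zero => exact isHomogeneous_one σ ℝ
  | one => exact (isHomogeneous_linearForm y).C_mul _
  | more l h0 h1 =>
    rw [zonal]
    refine IsHomogeneous.sub (IsHomogeneous.C_mul ?_ _) (IsHomogeneous.C_mul ?_ _)
    · have h := (isHomogeneous_linearForm y).mul h1
      rwa [show 1 + (l + 1) = l + 2 by ring] at h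
    · have h := isHomogeneous_normSqPoly.mul h0
      rwa [add_comm 2 l] at h

theorem dirDeriv_zonal (lam : ℝ) {y : σ → ℝ} (hy : ∑ i, y i ^ 2 = 1) (l : ℕ) :
    dirDeriv y (zonal lam y (l + 1)) = C ((l + 1) * (l + 2 * lam)) * zonal lam y l := by
  have hC (a : ℝ) (p : MvPolynomial σ ℝ) : dirDeriv y (C a * p) = C a * dirDeriv y p := by
    rw [← smul_eq_C_mul, ← smul_eq_C_mul, Derivation.map_smul]
  induction l using Nat.strong_induction_on with
  | _ l ih =>
    match l with
    | 0 => simp [zonal, hC, dirDeriv_linearForm hy]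
    | 1 =>
      simp only [zonal, hC, map_sub, Derivation.leibniz, dirDeriv_linearForm hy,
        dirDeriv_normSqPoly, smul_eq_mul, Derivation.map_one_eq_zero]
      simp only [map_add, map_mul, map_one, map_zero, map_ofNat, Nat.cast_zero, Nat.cast_one]
      ring
    | l + 2 =>
      have h0 := ih l (by omega)
      have h1 := ih (l + 1) (by omega)
      rw [zonal]
      simp only [map_sub, hC, Derivation.leibniz, dirDeriv_linearForm hy, dirDeriv_normSqPoly,
        h0, h1, smul_eq_mul]
      rw [zonal]
      simp only [map_add, map_mul, map_natCast, map_one, map_ofNat, Nat.cast_add, Nat.cast_one,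
        Nat.cast_ofNat]
      ring

/-- In the recurrence, only the derivative along the pole (`dirDeriv_zonal`) and the Euler term of
`normSqPoly` survive; they cancel exactly when `2 * lam + 2` is the dimension. -/
theorem laplacian_zonal {lam : ℝ} (hlam : 2 * lam + 2 = Fintype.card σ) {y : σ → ℝ}
    (hy : ∑ i, y i ^ 2 = 1) (l : ℕ) : laplacian (zonal lam y l) = 0 := by
  induction l using Nat.twoStepInduction with
  | zero => simp [zonal, laplacian]
  | one => simp [zonal, laplacian, pderiv_linearForm]
  | more l h0 h1 =>
    rw [zonal, laplacian_sub, laplacian_C_mul, laplacian_C_mul, laplacian_linearForm_mul,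
      laplacian_normSqPoly_mul (isHomogeneous_zonal lam y l), h0, h1, dirDeriv_zonal lam hy l,
      ← hlam]
    simp only [map_add, map_mul, map_natCast, map_one, map_ofNat]
    ring

/-- Modulo `normSqPoly` only the power of the linear form remains. Multiples of `normSqPoly` are
Fischer-orthogonal to harmonic polynomials, so only this power matters in `fischer_zonal`. -/
theorem zonal_eq_leading_add (lam : ℝ) (y : σ → ℝ) (l : ℕ) :
    ∃ s, zonal lam y l =
      C (∏ k ∈ Finset.range l, 2 * ((k : ℝ) + lam)) * linearForm y ^ l + normSqPoly * s := by
  induction l using Nat.twoStepInduction with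
  | zero => exact ⟨0, by simp [zonal]⟩
  | one => exact ⟨0, by simp [zonal]⟩
  | more l _ h1 =>
    obtain ⟨s, hs⟩ := h1
    refine ⟨C (2 * (l + 1 + lam)) * (linearForm y * s) -
      C ((l + 1) * (l + 2 * lam)) * zonal lam y l, ?_⟩
    rw [zonal, hs, Finset.prod_range_succ _ (l + 1)]
    simp only [map_mul, map_add, map_natCast, map_one, map_ofNat, Nat.cast_add, Nat.cast_one]
    ring

theorem eval_linearForm (y x : σ → ℝ) : eval x (linearForm y) = ∑ i, y i * x i := by
  simp [linearForm]

theorem eval_normSqPoly (x : σ → ℝ) : eval x normSqPoly = ∑ i, x i ^ 2 := by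
  simp [normSqPoly]

theorem eval_zonal (lam : ℝ) (y : σ → ℝ) {x : σ → ℝ} (hx : ∑ i, x i ^ 2 = 1) (l : ℕ) :
    eval x (zonal lam y l) = l.factorial * gegenbauer lam l (∑ i, y i * x i) := by
  induction l using Nat.twoStepInduction with
  | zero => simp [zonal, gegenbauer_zero]
  | one => simp [zonal, gegenbauer_one, eval_linearForm]
  | more l h0 h1 =>
    rw [gegenbauer_add_two, ← h0, ← h1, zonal]
    simp only [map_sub, map_mul, eval_C, eval_linearForm, eval_normSqPoly, hx]
    ring

/-- The reproducing property of zonal polynomials. -/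
theorem fischer_zonal {lam : ℝ} (hlam : 2 * lam + 2 = Fintype.card σ) {x y : σ → ℝ}
    (hx : ∑ i, x i ^ 2 = 1) (hy : ∑ i, y i ^ 2 = 1) (l : ℕ) :
    fischer (zonal lam x l) (zonal lam y l) =
      (∏ k ∈ Finset.range l, 2 * ((k : ℝ) + lam)) * (l.factorial : ℝ) ^ 2 *
        gegenbauer lam l (∑ i, x i * y i) := by
  obtain ⟨s, hs⟩ := zonal_eq_leading_add lam x l
  rw [hs, map_add, LinearMap.add_apply, fischer_normSqPoly_mul, laplacian_zonal hlam hy, map_zero,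
    add_zero, ← smul_eq_C_mul, map_smul, LinearMap.smul_apply,
    fischer_linearForm_pow (isHomogeneous_zonal lam y l), eval_zonal lam y hx, smul_eq_mul]
  simp only [mul_comm (y _)]
  ring

/-- If a combination of zonal polynomials vanishes in all degrees below `N`, then so do the
moments of order below `N` of the values of the linear forms of the poles. -/
theorem sum_mul_pow_eq_zero_of_zonal {ι : Type*} [Fintype ι] {lam : ℝ} (hlam : 0 < lam) {N : ℕ}
    (y : ι → σ → ℝ) (a : ι → ℝ) (h : ∀ l < N, ∑ i, a i • zonal lam (y i) l = 0) (v : σ → ℝ)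
    {m : ℕ} (hm : m < N) : ∑ i, a i * (∑ k, y i k * v k) ^ m = 0 := by
  -- Induction on `m` needs all degrees `l`: one factor `y i · v` is traded for a shift of `l` by at
  -- most one, within the budget `l + m < N`.
  suffices H : ∀ m l, l + m < N →
      ∑ i, a i * ((∑ k, y i k * v k) ^ m * eval v (zonal lam (y i) l)) = 0 by
    simpa [zonal] using H m 0 (by omega)
  intro m
  induction m with
  | zero =>
    intro l hl
    simpa [map_sum, smul_eval] using congrArg (eval v) (h l (by omega))
  | succ m ih =>
    intro l hl
    match l with
    | 0 =>
      have h1 := ih 1 (by omega)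
      simp only [zonal, map_mul, eval_C, eval_linearForm, map_one, mul_one] at h1 ⊢
      have h2 : 2 * lam * ∑ i, a i * (∑ k, y i k * v k) ^ (m + 1) = 0 := by
        rw [← h1, Finset.mul_sum]
        exact Finset.sum_congr rfl fun i _ => by ring
      exact (mul_eq_zero.mp h2).resolve_left (by positivity)
    | l + 1 =>
      have h1 := ih (l + 2) (by omega)
      have h0 := ih l (by omega)
      -- The recurrence solved for the linear form times `zonal` of degree `l + 1`; the value of
      -- `normSqPoly` at `v` does not depend on `i` and leaves the sum.
      have h2 : 2 * (l + 1 + lam) * ∑ i, a i *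
          ((∑ k, y i k * v k) ^ (m + 1) * eval v (zonal lam (y i) (l + 1))) = 0 := by
        refine Eq.trans (b := (l + 1) * (l + 2 * lam) * eval v normSqPoly *
          ∑ i, a i * ((∑ k, y i k * v k) ^ m * eval v (zonal lam (y i) l)) +
          ∑ i, a i * ((∑ k, y i k * v k) ^ m * eval v (zonal lam (y i) (l + 2)))) ?_
          (by rw [h0, h1, mul_zero, add_zero])
        rw [Finset.mul_sum, Finset.mul_sum, ← Finset.sum_add_distrib]
        refine Finset.sum_congr rfl fun i _ => ?_
        rw [zonal]
        simp only [map_sub, map_mul, eval_C, eval_linearForm]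
        ring
      exact (mul_eq_zero.mp h2).resolve_left (by positivity)

/-- Finitely many distinct points are separated by a linear form. -/
theorem exists_injective_linearForm {ι : Type*} [Finite ι] {y : ι → σ → ℝ}
    (hy : Function.Injective y) : ∃ v : σ → ℝ, Function.Injective fun i => ∑ k, y i k * v k := by
  classical
  -- Some functional is nonzero on each of the finitely many differences.
  obtain ⟨f, hf⟩ := Module.exists_dual_forall_apply_ne_zero (K := ℝ)
    (fun p : {p : ι × ι // p.1 ≠ p.2} => y p.1.1 - y p.1.2)
    (fun p => sub_ne_zero.mpr fun h => p.2 (hy h))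
  refine ⟨fun k => f (Pi.single k 1), fun i j hij => ?_⟩
  by_contra hne
  apply hf ⟨(i, j), hne⟩
  have h (z : σ → ℝ) : f z = ∑ k, z k * f (Pi.single k 1) := by
    rw [LinearMap.pi_apply_eq_sum_univ f z]
    refine Finset.sum_congr rfl fun k _ => ?_
    rw [smul_eq_mul]
    congr 2
    ext j
    simp [Pi.single_apply, eq_comm]
  rw [map_sub, h (y i), h (y j)]
  exact sub_eq_zero.mpr hij

end Zonal

/-! ### Gram matrices of the scaling function. -/

section Sphere

variable {n : ℕ}

theorem order_pos (hn : 2 ≤ n) : 0 < order n := by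
  have : (2 : ℝ) ≤ n := by exact_mod_cast hn
  rw [order]
  linarith

theorem sum_sq_eq_one (x : UnitSphere n) :
    ∑ i, (x : EuclideanSpace ℝ (Fin (n + 1))).ofLp i ^ 2 = 1 := by
  have h := EuclideanSpace.real_norm_sq_eq (x : EuclideanSpace ℝ (Fin (n + 1)))
  rw [← h, mem_sphere_zero_iff_norm.mp x.2, one_pow]

/-- The weights of the squares that represent the quadratic form of the scaling function. -/
noncomputable def squareWeight (n j l : ℕ) : ℝ :=
  1 / Real.sqrt 2 ^ (n * j) * (((l : ℝ) + order n) / order n) /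
    ((∏ k ∈ Finset.range l, 2 * ((k : ℝ) + order n)) * (l.factorial : ℝ) ^ 2)

theorem squareWeight_pos (hn : 2 ≤ n) (j l : ℕ) : 0 < squareWeight n j l := by
  have := order_pos hn
  have : 0 < ∏ k ∈ Finset.range l, 2 * ((k : ℝ) + order n) :=
    Finset.prod_pos fun _ _ => by positivity
  rw [squareWeight]
  positivity

theorem weightedScalingFunction_inner (hn : 2 ≤ n) (j : ℕ) (x y : UnitSphere n) :
    weightedScalingFunction n j (inner ℝ (x : EuclideanSpace ℝ (Fin (n + 1)))
      (y : EuclideanSpace ℝ (Fin (n + 1)))) =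
      ∑ l ∈ Finset.range (2 ^ (j - 1)), squareWeight n j l *
        fischer (zonal (order n) x.1.ofLp l) (zonal (order n) y.1.ofLp l) := by
  have hlam : 2 * order n + 2 = Fintype.card (Fin (n + 1)) := by
    rw [order, Fintype.card_fin]
    push_cast
    ring
  have hin : inner ℝ (x : EuclideanSpace ℝ (Fin (n + 1))) (y : EuclideanSpace ℝ (Fin (n + 1))) =
      ∑ i, x.1.ofLp i * y.1.ofLp i := by
    simp [PiLp.inner_apply, mul_comm]
  rw [weightedScalingFunction, hin, Finset.mul_sum]
  refine Finset.sum_congr rfl fun l _ => ?_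
  rw [fischer_zonal hlam (sum_sq_eq_one x) (sum_sq_eq_one y), squareWeight]
  have := order_pos hn
  have : 0 < ∏ k ∈ Finset.range l, 2 * ((k : ℝ) + order n) :=
    Finset.prod_pos fun _ _ => by positivity
  field_simp

theorem dotProduct_gramian_mulVec (hn : 2 ≤ n) (j : ℕ) {L : ℕ} (x : Fin L → UnitSphere n)
    (a : Fin L → ℝ) :
    star a ⬝ᵥ (gramian (weightedScalingFunction n j) x).mulVec a =
      ∑ l ∈ Finset.range (2 ^ (j - 1)), squareWeight n j l *
        fischer (∑ i, a i • zonal (order n) (x i).1.ofLp l)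
          (∑ i, a i • zonal (order n) (x i).1.ofLp l) := by
  simp only [dotProduct, Matrix.mulVec, gramian, Matrix.of_apply, weightedScalingFunction_inner hn,
    map_sum, map_smul, LinearMap.sum_apply, LinearMap.smul_apply, smul_eq_mul, Finset.mul_sum,
    Finset.sum_mul, Pi.star_apply, star_trivial]
  conv_rhs => rw [Finset.sum_comm]
  rw [Finset.sum_comm]
  refine Finset.sum_congr rfl fun i _ => ?_
  conv_rhs => rw [Finset.sum_comm]
  refine Finset.sum_congr rfl fun k _ => Finset.sum_congr rfl fun l _ => ?_
  ring

theorem isHermitian_gramian (G : ℝ → ℝ) {L : ℕ} (x : Fin L → UnitSphere n) :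
    (gramian G x).IsHermitian := by
  ext i k
  simp [gramian, real_inner_comm]

theorem continuousOn_weightedScalingFunction (n j : ℕ) :
    ContinuousOn (weightedScalingFunction n j) (Set.Icc (-1) 1) := by
  have h := continuous_gegenbauer (order n)
  unfold weightedScalingFunction
  fun_prop

theorem isPositiveDefinite_weightedScalingFunction (hn : 2 ≤ n) (j : ℕ) :
    IsPositiveDefinite n (weightedScalingFunction n j) := by
  refine ⟨continuousOn_weightedScalingFunction n j, fun L x =>
    .of_dotProduct_mulVec_nonneg (isHermitian_gramian _ x) fun a => ?_⟩
  rw [dotProduct_gramian_mulVec hn]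
  exact Finset.sum_nonneg fun l _ =>
    mul_nonneg (squareWeight_pos hn j l).le (fischer_self_nonneg _)

theorem isStrictlyPositiveDefiniteOfCard_weightedScalingFunction (hn : 2 ≤ n) (j : ℕ) :
    IsStrictlyPositiveDefiniteOfCard n (2 ^ (j - 1)) (weightedScalingFunction n j) := by
  refine ⟨continuousOn_weightedScalingFunction n j, fun x hx =>
    .of_dotProduct_mulVec_pos (isHermitian_gramian _ x) fun a ha => ?_⟩
  rw [dotProduct_gramian_mulVec hn]
  have hnn : ∀ l ∈ Finset.range (2 ^ (j - 1)), 0 ≤ squareWeight n j l *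
        fischer (∑ i, a i • zonal (order n) (x i).1.ofLp l)
          (∑ i, a i • zonal (order n) (x i).1.ofLp l) := fun l _ =>
    mul_nonneg (squareWeight_pos hn j l).le (fischer_self_nonneg _)
  refine lt_of_le_of_ne (Finset.sum_nonneg hnn) fun h0 => ha ?_
  have hz : ∀ l < 2 ^ (j - 1), ∑ i, a i • zonal (order n) (x i).1.ofLp l = 0 := fun l hl =>
    fischer_self_eq_zero ((mul_eq_zero.mp ((Finset.sum_eq_zero_iff_of_nonneg hnn).mp h0.symm l
      (Finset.mem_range.mpr hl))).resolve_left (squareWeight_pos hn j l).ne')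
  obtain ⟨v, hv⟩ := exists_injective_linearForm (y := fun i => (x i).1.ofLp)
    ((WithLp.ofLp_injective 2).comp (Subtype.val_injective.comp hx))
  -- Vandermonde: as many vanishing moments as distinct nodes `x i · v`.
  exact Matrix.eq_zero_of_forall_pow_sum_mul_pow_eq_zero hv fun m =>
    sum_mul_pow_eq_zero_of_zonal (order_pos hn) _ a hz v m.2

theorem infinite_unitSphere (hn : 1 ≤ n) : Infinite (UnitSphere n) := by
  have hrank : 1 < Module.rank ℝ (EuclideanSpace ℝ (Fin (n + 1))) := by
    rw [← Module.finrank_eq_rank, finrank_euclideanSpace_fin]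
    exact_mod_cast Nat.lt_succ_of_le hn
  obtain ⟨x, hx⟩ := NormedSpace.sphere_nonempty (E := EuclideanSpace ℝ (Fin (n + 1))) (x := 0)
    |>.mpr zero_le_one
  refine Set.infinite_coe_iff.mpr ((isPreconnected_sphere hrank 0 1).infinite_of_nontrivial
    ⟨x, hx, -x, by simpa using hx, fun h => ?_⟩)
  have h0 : x = 0 := by
    have h2 := add_eq_zero_iff_eq_neg.mpr h
    rwa [← two_smul ℝ, smul_eq_zero_iff_right two_ne_zero] at h2
  simp [h0] at hx

theorem not_isStrictlyPositiveDefinite_weightedScalingFunction (hn : 2 ≤ n) (j : ℕ) :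
    ¬ IsStrictlyPositiveDefinite n (weightedScalingFunction n j) := by
  intro h
  -- The product over all degrees lets a single relation `a` annihilate every degree at once.
  let V := Fin (2 ^ (j - 1)) → restrictTotalDegree (Fin (n + 1)) ℝ (2 ^ (j - 1))
  let L := Module.finrank ℝ V + 1
  have := infinite_unitSphere (n := n) (by omega)
  let x : Fin L ↪ UnitSphere n := Fin.valEmbedding.trans (Infinite.natEmbedding _)
  let w : Fin L → V := fun i l => ⟨zonal (order n) (x i).1.ofLp l,
    (mem_restrictTotalDegree _ _ _).mpr ((isHomogeneous_zonal _ _ _).totalDegree_le.trans l.2.le)⟩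
  have hdep : ¬ LinearIndependent ℝ w := fun hw => by
    have := hw.fintype_card_le_finrank
    simp [L] at this
  obtain ⟨a, ha, i, hi⟩ := Fintype.not_linearIndependent_iff.mp hdep
  have hpos := ((h L).2 x x.injective).dotProduct_mulVec_pos (x := a)
    fun h0 => hi (congrFun h0 i)
  rw [dotProduct_gramian_mulVec hn] at hpos
  refine hpos.ne' (Finset.sum_eq_zero fun l hl => ?_)
  have hz : ∑ i, a i • zonal (order n) (x i).1.ofLp l = 0 := by
    have := congrArg Subtype.val (congrFun ha ⟨l, Finset.mem_range.mp hl⟩)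
    rw [Finset.sum_apply, AddSubmonoidClass.coe_finsetSum] at this
    exact this
  simp [hz]

end Sphere

end SphereScaling

theorem mainTheorem11 (n j : ℕ) (hn : 2 ≤ n) (hj : 1 ≤ j) :
    SphereScaling.IsPositiveDefinite n (SphereScaling.weightedScalingFunction n j) ∧
    SphereScaling.IsStrictlyPositiveDefiniteOfCard n (2 ^ (j - 1))
      (SphereScaling.weightedScalingFunction n j) ∧
    ¬ SphereScaling.IsStrictlyPositiveDefinite n
      (SphereScaling.weightedScalingFunction n j) :=
  ⟨SphereScaling.isPositiveDefinite_weightedScalingFunction hn j,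
    SphereScaling.isStrictlyPositiveDefiniteOfCard_weightedScalingFunction hn j,
    SphereScaling.not_isStrictlyPositiveDefinite_weightedScalingFunction hn j⟩
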